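/- Setting. Let $S_1>1$ and $S_2\ge 1$ be integers and let $\eta_1,\zeta_1,\eta_2,\zeta_2$ be real numbers with $\eta_i^2+\zeta_i^2=1$, $\eta_1\zeta_1\neq 0$ and $\eta_1^2\neq\eta_2^2$. The signal path carries $S=S_1+S_2$ bosonic modes in two blocks, with annihilation operators $a_{1,1},\dots,a_{1,S_1}$ and $a_{2,1},\dots,a_{2,S_2}$, and the probe path carries $S$ modes $b_{i,j}$ indexed in the same way. A beam splitter characterized by the partition $S=S_1+S_2$ (of size $2$) acts by a photon-number preserving unitary $U$ that fixes the vacuum, with $$U^\dagger a_{i,j}U=\eta_i a_{i,j}+\zeta_i b_{i,j},\qquad U^\dagger b_{i,j}U=\zeta_i a_{i,j}-\eta_i b_{i,j}.$$ The probe is in the coherent state $|\gamma e_1\rangle$, of amplitude $\gamma\in\mathbb C$ in mode $b_{1,1}$ and vacuum in the other probe modes. After the beam splitter counter 1 counts the total photon number in the modes $a_{i,j}$ and counter 2 that in the modes $b_{i,j}$. If the signal is in the state $\rho$, the outcome $(k,l)$ has probability $$p_{kl}(\gamma)=\operatorname{tr}\bigl(D_{kl}\,U(\rho\otimes|\gamma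 e_1\rangle\langle\gamma e_1|)U^\dagger\bigr),$$ where $D_{kl}$ is the projection onto the span of the Fock states with $k$ photons in the modes of counter 1 and $l$ in those of counter 2. Let $\tilde\rho_3$ be a twirled state, that is, a density operator on the Fock space of the signal modes of the form $$\tilde\rho_3=\sum_{i_1,i_2\ge 0}\chi_{i_1i_2}\otimes|i_1\rangle\langle i_1|\otimes|i_2\rangle\langle i_2|,$$ with $\chi_{i_1i_2}$ acting on mode $a_{1,1}$, $|i_1\rangle$ and $|i_2\rangle$ Fock states of the modes $a_{1,2}$ and $a_{2,1}$, and all other modes in vacuum. To a polynomial in the variables $\alpha_{i,j},\alpha_{i,j}^*$ associate the operator obtained by replacing $\alpha_{i,j}$ by $a_{i,j}$ and $\alpha_{i,j}^*$ by $a_{i,j}^\dagger$ with the creation operators on the left in each monomial. Put $|\vec\alpha_i|^2=\sum_j\alpha_{i,j}^*\alpha_{i,j}$ and $|\vec\beta|^2=\sum_{j\ge2}\alpha_{1,j}^*\alpha_{1,j}$, and for $N\ge 0$ let $$\mathcal M_2(N)=\{(\alpha_{1,1}^*)^k\alpha_{1,1}^l|\vec\alpha_1|^{2c_1}|\vec\alpha_2|^{2c_2}:\max(k,l)+c_1+c_2\le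 N\},$$ $$\mathcal M_2'(N)=\{(\alpha_{1,1}^*)^k\alpha_{1,1}^l|\vec\beta|^{2c_1}|\vec\alpha_2|^{2c_2}:\max(k,l)+c_1+c_2\le N\}.$$ Let $\mathcal P_N$ be the space of functions of $\gamma\in\mathbb C$ spanned by $\gamma^k(\gamma^*)^l$ with $0\le k,l\le N$. Theorem. Let $\Gamma\subset\mathbb C$ be a finite set such that every $p\in\mathcal P_N$ with $p(\gamma)=0$ for all $\gamma\in\Gamma$ is $0$. Then the outcome distributions $(p_{kl}(\gamma))_{k,l\ge0}$ of both counters at all $\gamma\in\Gamma$ determine, among the twirled states $\tilde\rho_3$ with at most $N$ photons, the expectations of the operators associated with all members of $\mathcal M_2(N)$ and $\mathcal M_2'(N)$, and they determine $\tilde\rho_3$. That is, if two twirled states with at most $N$ photons have the same $p_{kl}(\gamma)$ for all $k,l\ge 0$ and all $\gamma\in\Gamma$, then all these expectations agree and the two states are equal. -/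

import Mathlib

noncomputable section

namespace WFH

open Finset

/- Modes and Fock space. -/

/-- The `S₁ + S₂` modes of one input path, grouped in the two blocks of the partition. -/
abbrev Modes (S₁ S₂ : ℕ) : Type := Fin S₁ ⊕ Fin S₂

/-- Occupation numbers of the modes in `σ`. -/
abbrev Occ (σ : Type) : Type := σ →₀ ℕ

/-- The bosonic Fock space of the modes in `σ`: square summable functions of the
occupation numbers. -/
abbrev Fock (σ : Type) : Type := lp (fun _ : Occ σ => ℂ) 2

/-- The product `∏ nᵢ!` of the factorials of the occupation numbers. -/
def occFactorial {σ : Type} [Fintype σ] (n : Occ σ) : ℕ := ∏ i, (n i).factorial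

open Classical in
/-- The Fock state `|n⟩`. -/
def ket {σ : Type} (n : Occ σ) : Fock σ := lp.single 2 n (1 : ℂ)

/-- The matrix element `⟨n|ρ|m⟩`. -/
def elem {σ : Type} (ρ : Fock σ →L[ℂ] Fock σ) (n m : Occ σ) : ℂ :=
  inner ℂ (ket n) (ρ (ket m))

/-- Density operators: positive operators of trace one. -/
def IsDensityOperator {σ : Type} (ρ : Fock σ →L[ℂ] Fock σ) : Prop :=
  ρ.IsPositive ∧ HasSum (fun n : Occ σ => elem ρ n n) 1

/-- The operator `ρ` vanishes on Fock states with more than `N` photons. -/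
def HasAtMostPhotons {σ : Type} (N : ℕ) (ρ : Fock σ →L[ℂ] Fock σ) : Prop :=
  ∀ n : Occ σ, N < n.degree → ρ (ket n) = 0

/- Normally ordered operators. They act on the algebraic Fock space `Occ σ →₀ ℂ`, the finite
linear combinations of Fock states. -/

/-- The product `∏ aᵢ ^ qᵢ` of annihilation operators,
`|n⟩ ↦ ∏ √(nᵢ (nᵢ - 1) ⋯ (nᵢ - qᵢ + 1)) |n - q⟩`; it kills `|n⟩` unless `q ≤ n`, because then
one of the falling factorials is zero. -/
def annihilate {σ : Type} [Fintype σ] (q : Occ σ) : (Occ σ →₀ ℂ) →ₗ[ℂ] (Occ σ →₀ ℂ) :=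
  Finsupp.linearCombination ℂ fun n : Occ σ =>
    Finsupp.single (n - q) ((√((∏ i, (n i).descFactorial (q i) : ℕ) : ℝ) : ℝ) : ℂ)

/-- The product `∏ (aᵢ†) ^ pᵢ` of creation operators,
`|n⟩ ↦ ∏ √((nᵢ + 1) ⋯ (nᵢ + pᵢ)) |n + p⟩`. -/
def create {σ : Type} [Fintype σ] (p : Occ σ) : (Occ σ →₀ ℂ) →ₗ[ℂ] (Occ σ →₀ ℂ) :=
  Finsupp.linearCombination ℂ fun n : Occ σ =>
    Finsupp.single (n + p) ((√((∏ i, (n i + 1).ascFactorial (p i) : ℕ) : ℝ) : ℝ) : ℂ)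

/-- The variable `αᵢ`. -/
def alpha {σ : Type} (i : σ) : MvPolynomial (σ ⊕ σ) ℂ := MvPolynomial.X (Sum.inl i)

/-- The variable `αᵢ*`. -/
def alphaStar {σ : Type} (i : σ) : MvPolynomial (σ ⊕ σ) ℂ := MvPolynomial.X (Sum.inr i)

/-- The operator corresponding to a polynomial in the variables `αᵢ` and `αᵢ*`: in each monomial
`αᵢ` is replaced by `aᵢ` and `αᵢ*` by `aᵢ†`, creation operators to the left. -/
def normalOrder {σ : Type} [Fintype σ] (f : MvPolynomial (σ ⊕ σ) ℂ) :
    (Occ σ →₀ ℂ) →ₗ[ℂ] (Occ σ →₀ ℂ) :=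
  ∑ d ∈ f.support, f.coeff d •
    (create (Finsupp.sumFinsuppEquivProdFinsupp d).2 ∘ₗ
      annihilate (Finsupp.sumFinsuppEquivProdFinsupp d).1)

/-- The expectation `tr (ρ A)` of the operator `A` corresponding to the polynomial `f`. For `ρ`
with boundedly many photons only finitely many terms of the trace are nonzero. -/
def expectation {σ : Type} [Fintype σ] (ρ : Fock σ →L[ℂ] Fock σ)
    (f : MvPolynomial (σ ⊕ σ) ℂ) : ℂ :=
  ∑' n : Occ σ, inner ℂ (ket n)
    (ρ (Finsupp.linearCombination ℂ ket (normalOrder f (Finsupp.single n 1))))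

/- The measurement. The modes of the two input paths, and also those of the two output paths, are
indexed by `Modes S₁ S₂ ⊕ Modes S₁ S₂`: left for the signal path and counter 1, right for the
probe path and counter 2. -/

/-- The block of the partition that a mode belongs to. -/
def block {S₁ S₂ : ℕ} : Modes S₁ S₂ → Fin 2 := Sum.elim (fun _ => 0) (fun _ => 1)

/-- The beam splitter `⨁ᵢ I_{Sᵢ} ⊗ (ηᵢ, ζᵢ; ζᵢ, -ηᵢ)` on creation operators: the creation operator
of an output mode as a linear form in those of the input modes, i.e.
`U† aⱼ† U = η aⱼ† + ζ bⱼ†` and `U† bⱼ† U = ζ aⱼ† - η bⱼ†`. -/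
def outputCreator {S₁ S₂ : ℕ} (η ζ : Fin 2 → ℝ) :
    Modes S₁ S₂ ⊕ Modes S₁ S₂ → MvPolynomial (Modes S₁ S₂ ⊕ Modes S₁ S₂) ℂ
  | Sum.inl j => MvPolynomial.C (η (block j) : ℂ) * MvPolynomial.X (Sum.inl j) +
      MvPolynomial.C (ζ (block j) : ℂ) * MvPolynomial.X (Sum.inr j)
  | Sum.inr j => MvPolynomial.C (ζ (block j) : ℂ) * MvPolynomial.X (Sum.inl j) -
      MvPolynomial.C (η (block j) : ℂ) * MvPolynomial.X (Sum.inr j)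

/-- The polynomial in the creation operators of the input modes that yields
`∏ √(mᵢ!) U†|m⟩` when applied to the vacuum. -/
def outputPoly {S₁ S₂ : ℕ} (η ζ : Fin 2 → ℝ) (m : Occ (Modes S₁ S₂ ⊕ Modes S₁ S₂)) :
    MvPolynomial (Modes S₁ S₂ ⊕ Modes S₁ S₂) ℂ :=
  ∏ i, outputCreator η ζ i ^ m i

/-- The matrix element `⟨n|U†|m⟩` of the beam splitter unitary `U` in the Fock basis; recall that
`∏ (aᵢ†) ^ nᵢ |0⟩ = ∏ √(nᵢ!) |n⟩`. -/
def amplitude {S₁ S₂ : ℕ} (η ζ : Fin 2 → ℝ) (n m : Occ (Modes S₁ S₂ ⊕ Modes S₁ S₂)) : ℂ :=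
  ((√(occFactorial n : ℝ) / √(occFactorial m : ℝ) : ℝ) : ℂ) * (outputPoly η ζ m).coeff n

/-- The Fock coefficient `⟨p|γ e₁⟩` of the probe, a coherent state of amplitude `γ` in the first
mode of the first block, with vacuum in the other modes. -/
def probe {S₁ S₂ : ℕ} [NeZero S₁] (γ : ℂ) (p : Occ (Modes S₁ S₂)) : ℂ :=
  (Real.exp (-‖γ‖ ^ 2 / 2) : ℂ) *
    ∏ i, (if i = Sum.inl 0 then γ else 0) ^ p i / ((√((p i).factorial : ℝ) : ℝ) : ℂ)

/-- The matrix element `⟨n| ρ ⊗ |γ e₁⟩⟨γ e₁| |n'⟩` of the joint input state. -/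
def jointElem {S₁ S₂ : ℕ} [NeZero S₁] (ρ : Fock (Modes S₁ S₂) →L[ℂ] Fock (Modes S₁ S₂))
    (γ : ℂ) (n n' : Occ (Modes S₁ S₂ ⊕ Modes S₁ S₂)) : ℂ :=
  elem ρ (Finsupp.sumFinsuppEquivProdFinsupp n).1 (Finsupp.sumFinsuppEquivProdFinsupp n').1 *
    (probe γ (Finsupp.sumFinsuppEquivProdFinsupp n).2 *
      star (probe γ (Finsupp.sumFinsuppEquivProdFinsupp n').2))

/-- The probability, by the Born rule, that counter 1 registers `k` and counter 2 registers `l`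
photons at probe amplitude `γ`, if the signal is in the state `ρ`: the trace of
`D_{kl} U (ρ ⊗ |γ e₁⟩⟨γ e₁|) U†`, where `D_{kl}` projects on the span of the `|m₁⟩ ⊗ |m₂⟩` with
`k` photons in `m₁` and `l` photons in `m₂`. The vectors `U†|m⟩` have finitely many nonzero
coordinates. -/
def outcomeProb {S₁ S₂ : ℕ} [NeZero S₁] (η ζ : Fin 2 → ℝ)
    (ρ : Fock (Modes S₁ S₂) →L[ℂ] Fock (Modes S₁ S₂)) (γ : ℂ) (k l : ℕ) : ℂ :=
  ∑ m₁ ∈ finsuppAntidiag (univ : Finset (Modes S₁ S₂)) k,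
    ∑ m₂ ∈ finsuppAntidiag (univ : Finset (Modes S₁ S₂)) l,
      ∑ n ∈ (outputPoly η ζ (Finsupp.sumElim m₁ m₂)).support,
        ∑ n' ∈ (outputPoly η ζ (Finsupp.sumElim m₁ m₂)).support,
          star (amplitude η ζ n (Finsupp.sumElim m₁ m₂)) * jointElem ρ γ n n' *
            amplitude η ζ n' (Finsupp.sumElim m₁ m₂)

/- Twirled states and the expressions whose expectations are determined. -/

/-- `ρ` has the form `∑ χ_{i₁ i₂} ⊗ |i₁⟩⟨i₁| ⊗ |i₂⟩⟨i₂|`, where `χ_{i₁ i₂}` acts on the first mode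
of the first block, `|i₁⟩` is a Fock state of the second mode of the first block and `|i₂⟩` one of
the first mode of the second block; all other modes are in vacuum. -/
def IsTwirled {S₁ S₂ : ℕ} [NeZero S₁] [NeZero S₂]
    (ρ : Fock (Modes S₁ S₂) →L[ℂ] Fock (Modes S₁ S₂)) : Prop :=
  ∀ n m : Occ (Modes S₁ S₂), elem ρ n m ≠ 0 →
    (∀ i, i ≠ Sum.inl 0 → n i = m i) ∧
    (∀ i, i ≠ Sum.inl 0 → i ≠ Sum.inl 1 → i ≠ Sum.inr 0 → n i = 0)

/-- `m₂(k, l, c₁, c₂) = (α₁*)ᵏ α₁ˡ |α⃗₁|^(2 c₁) |α⃗₂|^(2 c₂)`. -/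
def mPoly (S₁ S₂ : ℕ) [NeZero S₁] (k l c₁ c₂ : ℕ) :
    MvPolynomial (Modes S₁ S₂ ⊕ Modes S₁ S₂) ℂ :=
  alphaStar (Sum.inl 0) ^ k * alpha (Sum.inl 0) ^ l *
    (∑ i : Fin S₁, alphaStar (Sum.inl i) * alpha (Sum.inl i)) ^ c₁ *
    (∑ j : Fin S₂, alphaStar (Sum.inr j) * alpha (Sum.inr j)) ^ c₂

/-- `m₂′(k, l, c₁, c₂) = (α₁*)ᵏ α₁ˡ |β⃗|^(2 c₁) |α⃗₂|^(2 c₂)`, where `α⃗₁ = α₁ ⊕ β⃗`. -/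
def mPrimePoly (S₁ S₂ : ℕ) [NeZero S₁] (k l c₁ c₂ : ℕ) :
    MvPolynomial (Modes S₁ S₂ ⊕ Modes S₁ S₂) ℂ :=
  alphaStar (Sum.inl 0) ^ k * alpha (Sum.inl 0) ^ l *
    (∑ i ∈ (univ : Finset (Fin S₁)).erase 0, alphaStar (Sum.inl i) * alpha (Sum.inl i)) ^ c₁ *
    (∑ j : Fin S₂, alphaStar (Sum.inr j) * alpha (Sum.inr j)) ^ c₂

/-- The space `𝓟_N` of functions of `γ` spanned by the `γᵏ (γ*)ˡ` with `k, l ≤ N`. -/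
def polySpace (N : ℕ) : Submodule ℂ (ℂ → ℂ) :=
  Submodule.span ℂ {p | ∃ k ≤ N, ∃ l ≤ N, p = fun γ => γ ^ k * star γ ^ l}

/-- The only element of `𝓟_N` that vanishes on `Γ` is zero. -/
def IsUnisolvent (N : ℕ) (Γ : Finset ℂ) : Prop :=
  ∀ p ∈ polySpace N, (∀ γ ∈ Γ, p γ = 0) → p = 0

end WFH

end

/-!
# Twirled states are determined by the statistics of both counters

The expectations are functions of the state, so it suffices to recover the state itself. Let `D` be
the difference of two density matrices in the Fock basis and let `pairing D` be the linear
functional `sⁿ tᵐ ↦ √(n! m!) D n m` on polynomials in commuting variables `sᵢ`, `tᵢ`.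

Contracting the probe modes with the coherent state and summing over output Fock states by the
multinomial theorem gives (`outcomeProb_eq`)
`p_{kl}(γ) = e^{-|γ|²} / (k! l!) · pairing (Aᵏ Bˡ)`, where, with `Pᵢ = ∑ⱼ sᵢⱼ tᵢⱼ` and
`W = γ t₁₁ + γ* s₁₁`,
`A = η₁² P₁ + η₂² P₂ + η₁ζ₁ W + ζ₁² |γ|²` and `B = ζ₁² P₁ + ζ₂² P₂ - η₁ζ₁ W + η₁² |γ|²`.
Hence equal statistics make the pairing vanish on the whole algebra generated by `A` and `B`. This
algebra contains `x A + y B` without its constant `|γ|²`-term, that is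
`z₁ P₁ + z₂ P₂ + (x - y) η₁ζ₁ W` with `zᵢ = x ηᵢ² + y ζᵢ²`. Its powers pair to polynomials in `γ`
and `γ*` that lie in `polySpace N`, since `D` has at most `N` photons; unisolvence makes them zero
for all `γ`. For `x ≠ y` the coefficients of `γᵖ (γ*)ᵠ` show that `(z₁ P₁ + z₂ P₂)ʳ t₁₁ᵖ s₁₁ᵠ` pairs
to zero (`pairing_combination_eq_zero`). As `η₁² ≠ η₂²`, all `z₁ ≠ z₂` occur, so that
`P₁ᵉ P₂ᶠ t₁₁ᵖ s₁₁ᵠ` pairs to zero (`pairing_blockPoly_eq_zero`).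

On a twirled matrix `P₁` and `P₂` act as `s₁₁ t₁₁ + s₁₂ t₁₂` and `s₂₁ t₂₁`. Expanding `P₁ᵉ` and
arguing by induction on the occupation number of the second mode, every entry of `D` vanishes
(`entry_occ₃_eq_zero`).
-/

noncomputable section

namespace WFH

open Finset MvPolynomial

/-! ### Contraction of polynomials with a matrix -/

/-- The linear functional on polynomials in commuting variables `sᵢ = X (inl i)` and
`tᵢ = X (inr i)` sending `sⁿ tᵐ` to `√(n! m!) D n m`. -/
def pairing {σ : Type} [Fintype σ] (D : Occ σ → Occ σ → ℂ) :
    MvPolynomial (σ ⊕ σ) ℂ →ₗ[ℂ] ℂ :=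
  (basisMonomials (σ ⊕ σ) ℂ).constr ℂ fun d =>
    ((√(occFactorial (Finsupp.sumFinsuppEquivProdFinsupp d).1 : ℝ) *
      √(occFactorial (Finsupp.sumFinsuppEquivProdFinsupp d).2 : ℝ) : ℝ) : ℂ) *
      D (Finsupp.sumFinsuppEquivProdFinsupp d).1 (Finsupp.sumFinsuppEquivProdFinsupp d).2

theorem split_sumElim {σ τ : Type} (n : Occ σ) (m : Occ τ) :
    Finsupp.sumFinsuppEquivProdFinsupp (Finsupp.sumElim n m) = (n, m) := by
  ext i <;> simp

theorem exists_eq_sumElim {σ τ : Type} (d : Occ (σ ⊕ τ)) : ∃ n m, d = Finsupp.sumElim n m :=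
  ⟨_, _, (Finsupp.comapDomain_sumElim_comapDomain d).symm⟩

section pairing

variable {σ : Type} [Fintype σ]

theorem pairing_monomial (D : Occ σ → Occ σ → ℂ) (n m : Occ σ) (c : ℂ) :
    pairing D (monomial (Finsupp.sumElim n m) c) =
      c * (((√(occFactorial n : ℝ) * √(occFactorial m : ℝ) : ℝ) : ℂ) * D n m) := by
  have h := (basisMonomials (σ ⊕ σ) ℂ).constr_basis ℂ (fun d =>
    ((√(occFactorial (Finsupp.sumFinsuppEquivProdFinsupp d).1 : ℝ) *
      √(occFactorial (Finsupp.sumFinsuppEquivProdFinsupp d).2 : ℝ) : ℝ) : ℂ) *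
      D (Finsupp.sumFinsuppEquivProdFinsupp d).1 (Finsupp.sumFinsuppEquivProdFinsupp d).2)
      (Finsupp.sumElim n m)
  rw [split_sumElim, coe_basisMonomials] at h
  rw [← mul_one c, ← smul_eq_mul, ← smul_monomial, map_smul, smul_eq_mul, smul_eq_mul, mul_one]
  exact congrArg (c * ·) h

theorem pairing_sub (D D' : Occ σ → Occ σ → ℂ) (f : MvPolynomial (σ ⊕ σ) ℂ) :
    pairing (fun n m => D n m - D' n m) f = pairing D f - pairing D' f := by
  induction f using MvPolynomial.induction_on' with
  | monomial d c =>
    obtain ⟨n, m, rfl⟩ := exists_eq_sumElim d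
    simp only [pairing_monomial]
    ring
  | add p q hp hq => simp only [map_add, hp, hq]; ring

theorem occFactorial_pos (n : Occ σ) : 0 < occFactorial n :=
  Finset.prod_pos fun _ _ => Nat.factorial_pos _

end pairing

/-! ### The Born rule as a contraction -/

/-- The multinomial theorem with divided powers. -/
theorem sum_prod_pow_div_factorial {σ R : Type} [Fintype σ] [DecidableEq σ] [CommRing R]
    [Algebra ℂ R] (x : σ → R) (k : ℕ) :
    ∑ m ∈ finsuppAntidiag (univ : Finset σ) k, ((occFactorial m : ℂ)⁻¹) • ∏ i, x i ^ m i =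
      ((k.factorial : ℂ)⁻¹) • (∑ i, x i) ^ k := by
  rw [Finset.sum_pow_eq_sum_piAntidiag, Finset.smul_sum]
  refine Finset.sum_nbij (fun m => ⇑m) ?_ ?_ ?_ ?_
  · intro m hm
    simp_all [mem_finsuppAntidiag]
  · exact fun a _ b _ h => DFunLike.coe_injective h
  · intro f hf
    refine ⟨Finsupp.equivFunOnFinite.symm f, ?_, rfl⟩
    simp_all [mem_finsuppAntidiag]
  · intro m hm
    have h1 : ∑ i, m i = k := by simp_all [mem_finsuppAntidiag]
    have h := Nat.multinomial_spec (univ : Finset σ) m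
    rw [h1] at h
    have h2 : (occFactorial m : ℂ) * (Nat.multinomial univ m : ℂ) = k.factorial := by
      exact_mod_cast h
    have h3 : (occFactorial m : ℂ) ≠ 0 := by exact_mod_cast (occFactorial_pos m).ne'
    have h4 : (Nat.multinomial univ m : ℂ) ≠ 0 := by
      intro h0
      rw [h0, mul_zero] at h2
      exact Nat.factorial_ne_zero k (by exact_mod_cast h2.symm)
    have h5 : (occFactorial m : ℂ)⁻¹ = (k.factorial : ℂ)⁻¹ * (Nat.multinomial univ m : ℂ) := by
      rw [← h2]; field_simp
    rw [h5, mul_smul, ← nsmul_eq_mul, ← Nat.cast_smul_eq_nsmul ℂ]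

/-- Beam splitter amplitudes are real. -/
theorem star_coeff_outputPoly {S₁ S₂ : ℕ} (η ζ : Fin 2 → ℝ) (m n : Occ (Modes S₁ S₂ ⊕ Modes S₁ S₂)) :
    star ((outputPoly η ζ m).coeff n) = (outputPoly η ζ m).coeff n := by
  have h : map (starRingEnd ℂ) (outputPoly η ζ m) = outputPoly η ζ m := by
    rw [outputPoly, map_prod]
    refine Finset.prod_congr rfl fun i _ => ?_
    rcases i with i | i <;> simp [outputCreator]
  conv_rhs => rw [← h, coeff_map]
  rfl

section outcome

variable {S₁ S₂ : ℕ} [NeZero S₁]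

/-- The amplitude of the coherent probe in each mode. -/
def probeAmp (γ : ℂ) (i : Modes S₁ S₂) : ℂ := if i = Sum.inl 0 then γ else 0

/-- Contraction with the probe on the ket side: signal variables go to `sᵢ`, probe variables to
the amplitudes of the coherent state. -/
def ketHom (γ : ℂ) : MvPolynomial (Modes S₁ S₂ ⊕ Modes S₁ S₂) ℂ →ₐ[ℂ]
    MvPolynomial (Modes S₁ S₂ ⊕ Modes S₁ S₂) ℂ :=
  aeval (Sum.elim (fun i => X (Sum.inl i)) fun i => C (probeAmp γ i))

/-- Contraction with the probe on the bra side: signal variables go to `tᵢ`, probe variables to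
the conjugate amplitudes of the coherent state. -/
def braHom (γ : ℂ) : MvPolynomial (Modes S₁ S₂ ⊕ Modes S₁ S₂) ℂ →ₐ[ℂ]
    MvPolynomial (Modes S₁ S₂ ⊕ Modes S₁ S₂) ℂ :=
  aeval (Sum.elim (fun i => X (Sum.inr i)) fun i => C (star (probeAmp γ i)))

theorem monomial_inl {σ τ : Type} [Fintype σ] (n : Occ σ) :
    ∏ i, (X (Sum.inl i) : MvPolynomial (σ ⊕ τ) ℂ) ^ n i = monomial (Finsupp.sumElim n 0) 1 := by
  rw [monomial_eq, C_1, one_mul, Finsupp.prod_sumElim, Finsupp.prod_zero_index, mul_one,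
    Finsupp.prod_fintype _ _ (by simp)]
  rfl

theorem monomial_inr {σ τ : Type} [Fintype τ] (n : Occ τ) :
    ∏ i, (X (Sum.inr i) : MvPolynomial (σ ⊕ τ) ℂ) ^ n i = monomial (Finsupp.sumElim 0 n) 1 := by
  rw [monomial_eq, C_1, one_mul, Finsupp.prod_sumElim, Finsupp.prod_zero_index, one_mul,
    Finsupp.prod_fintype _ _ (by simp)]
  rfl

theorem ketHom_monomial (γ : ℂ) (n p : Occ (Modes S₁ S₂)) :
    ketHom γ (monomial (Finsupp.sumElim n p) 1) =
      monomial (Finsupp.sumElim n 0) (∏ i, probeAmp γ i ^ p i) := by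
  rw [ketHom, aeval_monomial, map_one, one_mul, Finsupp.prod_sumElim,
    Finsupp.prod_fintype _ _ (by simp), Finsupp.prod_fintype _ _ (by simp)]
  simp only [Function.comp_apply, Sum.elim_inl, Sum.elim_inr, ← C_pow, ← map_prod]
  rw [monomial_inl, mul_comm, C_mul_monomial, mul_one]

theorem braHom_monomial (γ : ℂ) (n p : Occ (Modes S₁ S₂)) :
    braHom γ (monomial (Finsupp.sumElim n p) 1) =
      monomial (Finsupp.sumElim 0 n) (star (∏ i, probeAmp γ i ^ p i)) := by
  rw [braHom, aeval_monomial, map_one, one_mul, Finsupp.prod_sumElim,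
    Finsupp.prod_fintype _ _ (by simp), Finsupp.prod_fintype _ _ (by simp)]
  simp only [Function.comp_apply, Sum.elim_inl, Sum.elim_inr, ← C_pow, ← map_prod]
  rw [monomial_inr, mul_comm, C_mul_monomial, mul_one]
  simp

theorem probe_eq (γ : ℂ) (p : Occ (Modes S₁ S₂)) :
    probe γ p = (Real.exp (-‖γ‖ ^ 2 / 2) : ℂ) *
      ((∏ i, probeAmp γ i ^ p i) / ((√(occFactorial p : ℝ) : ℝ) : ℂ)) := by
  rw [probe, prod_div_distrib, occFactorial, Nat.cast_prod,
    Real.sqrt_prod _ (fun i _ => Nat.cast_nonneg _), Complex.ofReal_prod]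
  rfl

theorem occFactorial_sumElim {σ τ : Type} [Fintype σ] [Fintype τ] (n : Occ σ) (p : Occ τ) :
    occFactorial (Finsupp.sumElim n p) = occFactorial n * occFactorial p := by
  simp [occFactorial, Fintype.prod_sum_type]

/-- Contracting the probe modes with the coherent state turns an entry of the joint input state
into a pairing with the signal state alone. -/
theorem sqrt_mul_jointElem (ρ : Fock (Modes S₁ S₂) →L[ℂ] Fock (Modes S₁ S₂)) (γ : ℂ)
    (n n' : Occ (Modes S₁ S₂ ⊕ Modes S₁ S₂)) :
    ((√(occFactorial n : ℝ) : ℝ) : ℂ) * jointElem ρ γ n n' * ((√(occFactorial n' : ℝ) : ℝ) : ℂ) =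
      (Real.exp (-‖γ‖ ^ 2) : ℂ) *
        pairing (elem ρ) (ketHom γ (monomial n 1) * braHom γ (monomial n' 1)) := by
  obtain ⟨n, p, rfl⟩ := exists_eq_sumElim n
  obtain ⟨n', p', rfl⟩ := exists_eq_sumElim n'
  have hexp : (Real.exp (-‖γ‖ ^ 2) : ℂ) =
      (Real.exp (-‖γ‖ ^ 2 / 2) : ℂ) * (Real.exp (-‖γ‖ ^ 2 / 2) : ℂ) := by
    rw [← Complex.ofReal_mul, ← Real.exp_add, add_halves]
  have hs (p : Occ (Modes S₁ S₂)) : ((√(occFactorial p : ℝ) : ℝ) : ℂ) ≠ 0 := by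
    have := occFactorial_pos p
    exact Complex.ofReal_ne_zero.2 (Real.sqrt_pos.2 (by exact_mod_cast this)).ne'
  have h1 := hs p
  have h2 := hs p'
  rw [ketHom_monomial, braHom_monomial, monomial_mul, ← Finsupp.sumElim_add, add_zero, zero_add,
    pairing_monomial, jointElem, split_sumElim, split_sumElim, probe_eq, probe_eq,
    occFactorial_sumElim, occFactorial_sumElim, hexp]
  simp only [Nat.cast_mul, Real.sqrt_mul (Nat.cast_nonneg _), Complex.ofReal_mul, star_mul',
    star_div₀, Complex.star_def, Complex.conj_ofReal]
  field_simp

/-- The probability of the output Fock state `|m⟩`. -/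
theorem sum_amplitude (η ζ : Fin 2 → ℝ) (ρ : Fock (Modes S₁ S₂) →L[ℂ] Fock (Modes S₁ S₂)) (γ : ℂ)
    (m : Occ (Modes S₁ S₂ ⊕ Modes S₁ S₂)) :
    ∑ n ∈ (outputPoly η ζ m).support, ∑ n' ∈ (outputPoly η ζ m).support,
      star (amplitude η ζ n m) * jointElem ρ γ n n' * amplitude η ζ n' m =
    (Real.exp (-‖γ‖ ^ 2) : ℂ) * pairing (elem ρ) ((occFactorial m : ℂ)⁻¹ •
      (ketHom γ (outputPoly η ζ m) * braHom γ (outputPoly η ζ m))) := by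
  have hm : ((√(occFactorial m : ℝ) : ℝ) : ℂ)⁻¹ * ((√(occFactorial m : ℝ) : ℝ) : ℂ)⁻¹ =
      (occFactorial m : ℂ)⁻¹ := by
    rw [← mul_inv, ← Complex.ofReal_mul, Real.mul_self_sqrt (Nat.cast_nonneg _)]
    simp
  have hQ : outputPoly η ζ m =
      ∑ n ∈ (outputPoly η ζ m).support, (outputPoly η ζ m).coeff n • monomial n (1 : ℂ) := by
    conv_lhs => rw [(outputPoly η ζ m).as_sum]
    simp [smul_monomial]
  conv_rhs => rw [hQ]
  simp only [map_sum, map_smul]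
  rw [sum_mul_sum]
  simp only [map_sum, map_smul, mul_sum, smul_mul_smul_comm, smul_eq_mul]
  refine Finset.sum_congr rfl fun n _ => Finset.sum_congr rfl fun n' _ => ?_
  rw [mul_left_comm, mul_left_comm _ _ (pairing _ _), ← sqrt_mul_jointElem, ← hm]
  simp only [amplitude, star_mul', star_coeff_outputPoly, Complex.star_def, Complex.conj_ofReal]
  rw [Complex.ofReal_div, Complex.ofReal_div]
  ring

/-- The photon number of counter 1 as a polynomial in the signal variables, the probe variables
being replaced by the amplitudes of the coherent state. -/
def counterPoly₁ (η ζ : Fin 2 → ℝ) (γ : ℂ) : MvPolynomial (Modes S₁ S₂ ⊕ Modes S₁ S₂) ℂ :=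
  ∑ i : Modes S₁ S₂, (ketHom γ (outputCreator η ζ (Sum.inl i)) *
    braHom γ (outputCreator η ζ (Sum.inl i)))

/-- The photon number of counter 2 as a polynomial in the signal variables, the probe variables
being replaced by the amplitudes of the coherent state. -/
def counterPoly₂ (η ζ : Fin 2 → ℝ) (γ : ℂ) : MvPolynomial (Modes S₁ S₂ ⊕ Modes S₁ S₂) ℂ :=
  ∑ i : Modes S₁ S₂, (ketHom γ (outputCreator η ζ (Sum.inr i)) *
    braHom γ (outputCreator η ζ (Sum.inr i)))

/-- Summing over all output Fock states with `k` and `l` photons in the two counters gives, by the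
multinomial theorem, the powers of the two counter polynomials. -/
theorem outcomeProb_eq (η ζ : Fin 2 → ℝ) (ρ : Fock (Modes S₁ S₂) →L[ℂ] Fock (Modes S₁ S₂)) (γ : ℂ)
    (k l : ℕ) : outcomeProb η ζ ρ γ k l =
      (Real.exp (-‖γ‖ ^ 2) : ℂ) * ((k.factorial : ℂ)⁻¹ * (l.factorial : ℂ)⁻¹) *
        pairing (elem ρ) (counterPoly₁ η ζ γ ^ k * counterPoly₂ η ζ γ ^ l) := by
  have h : ((k.factorial : ℂ)⁻¹ * (l.factorial : ℂ)⁻¹) *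
      pairing (elem ρ) (counterPoly₁ η ζ γ ^ k * counterPoly₂ η ζ γ ^ l) =
      pairing (elem ρ) (((k.factorial : ℂ)⁻¹ • counterPoly₁ η ζ γ ^ k) *
        ((l.factorial : ℂ)⁻¹ • counterPoly₂ η ζ γ ^ l)) := by
    rw [smul_mul_smul_comm, map_smul, smul_eq_mul]
  rw [mul_assoc, h, counterPoly₁, counterPoly₂, ← sum_prod_pow_div_factorial,
    ← sum_prod_pow_div_factorial, sum_mul_sum, map_sum, mul_sum, outcomeProb]
  refine Finset.sum_congr rfl fun m₁ _ => ?_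
  rw [map_sum, mul_sum]
  refine Finset.sum_congr rfl fun m₂ _ => ?_
  rw [sum_amplitude, occFactorial_sumElim, smul_mul_smul_comm]
  congr 3
  · push_cast
    rw [mul_inv]
  · simp only [outputPoly, Fintype.prod_sum_type, map_mul, map_prod, map_pow,
      Finsupp.sumElim_inl, Finsupp.sumElim_inr, mul_pow, prod_mul_distrib]
    ring

end outcome

/-! ### Extraction of coefficients -/

theorem coeff_eq_zero_of_infinite {s : Set ℂ} (hs : s.Infinite) {n : ℕ} {c : ℕ → ℂ}
    (h : ∀ z ∈ s, ∑ i ∈ range n, c i * z ^ i = 0) {i : ℕ} (hi : i < n) : c i = 0 := by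
  have hP : (∑ i ∈ range n, Polynomial.C (c i) * Polynomial.X ^ i) = 0 := by
    refine Polynomial.eq_zero_of_infinite_isRoot _ (hs.mono fun z hz => ?_)
    simpa [Polynomial.IsRoot, Polynomial.eval_finsetSum] using h z hz
  simpa [Polynomial.finsetSum_coeff, Polynomial.coeff_X_pow, hi] using
    congrArg (fun P => Polynomial.coeff P i) hP

/-- The functions `γᵖ (γ*)ᵠ` are linearly independent. -/
theorem coeff_eq_zero_of_conj {n : ℕ} {c : ℕ → ℕ → ℂ}
    (h : ∀ z : ℂ, ∑ p ∈ range n, ∑ q ∈ range n, c p q * (z ^ p * star z ^ q) = 0)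
    {p q : ℕ} (hp : p < n) (hq : q < n) : c p q = 0 := by
  -- With `z = u + v i`, a polynomial in `u` and `v` that vanishes for real `u` and `v` vanishes
  -- for complex `u` and `v`, so `z` and `z*` may be treated as independent.
  have hR : (Set.range ((↑) : ℝ → ℂ)).Infinite :=
    Set.infinite_range_of_injective Complex.ofReal_injective
  have h1 (u : ℂ) (v : ℝ) : ∑ p ∈ range n, ∑ q ∈ range n,
      c p q * ((u + v * Complex.I) ^ p * (u - v * Complex.I) ^ q) = 0 := by
    have hP : (∑ p ∈ range n, ∑ q ∈ range n, Polynomial.C (c p q) *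
        ((Polynomial.X + Polynomial.C (v * Complex.I)) ^ p *
          (Polynomial.X - Polynomial.C (v * Complex.I)) ^ q)) = 0 := by
      refine Polynomial.eq_zero_of_infinite_isRoot _ (hR.mono ?_)
      rintro _ ⟨x, rfl⟩
      have := h (x + v * Complex.I)
      simpa [Polynomial.IsRoot, Polynomial.eval_finsetSum, sub_eq_add_neg] using this
    simpa [Polynomial.eval_finsetSum] using congrArg (Polynomial.eval u) hP
  have h2 (u v : ℂ) : ∑ p ∈ range n, ∑ q ∈ range n,
      c p q * ((u + v * Complex.I) ^ p * (u - v * Complex.I) ^ q) = 0 := by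
    have hP : (∑ p ∈ range n, ∑ q ∈ range n, Polynomial.C (c p q) *
        ((Polynomial.C u + Polynomial.X * Polynomial.C Complex.I) ^ p *
          (Polynomial.C u - Polynomial.X * Polynomial.C Complex.I) ^ q)) = 0 := by
      refine Polynomial.eq_zero_of_infinite_isRoot _ (hR.mono ?_)
      rintro _ ⟨x, rfl⟩
      simpa [Polynomial.IsRoot, Polynomial.eval_finsetSum, mul_comm Complex.I] using h1 u x
    simpa [Polynomial.eval_finsetSum, mul_comm Complex.I] using congrArg (Polynomial.eval v) hP
  have h3 (g g' : ℂ) : ∑ p ∈ range n, ∑ q ∈ range n, c p q * (g ^ p * g' ^ q) = 0 := by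
    have := h2 ((g + g') / 2) (-Complex.I * (g - g') / 2)
    have e : -Complex.I * (g - g') / 2 * Complex.I = (g - g') / 2 := by
      linear_combination (-(g - g') / 2) * Complex.I_mul_I
    rw [e] at this
    convert this using 6 <;> ring
  have h4 (g' : ℂ) : ∑ q ∈ range n, c p q * g' ^ q = 0 :=
    coeff_eq_zero_of_infinite (c := fun p => ∑ q ∈ range n, c p q * g' ^ q) Set.infinite_univ
      (fun g _ => by
        rw [← h3 g g']
        simp only [sum_mul]
        exact Finset.sum_congr rfl fun _ _ => Finset.sum_congr rfl fun _ _ => by ring) hp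
  exact coeff_eq_zero_of_infinite Set.infinite_univ (fun g' _ => h4 g') hq

theorem map_eq_zero_of_mem_adjoin_pair {R : Type} [CommRing R] [Algebra ℂ R] (L : R →ₗ[ℂ] ℂ)
    {A B : R} (h : ∀ k l : ℕ, L (A ^ k * B ^ l) = 0) {f : R}
    (hf : f ∈ Algebra.adjoin ℂ {A, B}) : L f = 0 := by
  rw [← Subalgebra.mem_toSubmodule, Algebra.adjoin_eq_span] at hf
  have : Submodule.span ℂ (Submonoid.closure {A, B} : Set R) ≤ LinearMap.ker L := by
    refine Submodule.span_le.2 fun x hx => ?_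
    obtain ⟨k, l, rfl⟩ := (Submonoid.mem_closure_pair _ _ _).1 hx
    exact h k l
  exact this hf

theorem map_trinomial_pow {R : Type} [CommRing R] [Algebra ℂ R] (L : R →ₗ[ℂ] ℂ) (Z T S : R)
    (a b : ℂ) (M : ℕ) :
    L ((Z + a • T + b • S) ^ M) = ∑ p ∈ range (M + 1), ∑ q ∈ range (M + 1),
      ((M.choose q : ℂ) * ((M - q).choose p : ℂ) * L (Z ^ (M - q - p) * T ^ p * S ^ q)) *
        (a ^ p * b ^ q) := by
  rw [add_comm, add_pow, map_sum, sum_comm]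
  refine Finset.sum_congr rfl fun q _ => ?_
  rw [add_comm Z, add_pow, ← Finset.sum_subset (range_subset_range.2 (by lia : M - q + 1 ≤ M + 1)),
    mul_sum, sum_mul, map_sum]
  · refine Finset.sum_congr rfl fun p _ => ?_
    have e (u v w : ℂ) (x : R) : u * v * L x * w = L ((u * v * w) • x) := by
      rw [map_smul, smul_eq_mul]; ring
    rw [e]
    congr 1
    simp only [Algebra.smul_def, map_mul, map_pow, map_natCast]
    ring
  · intro p _ hp
    have hlt : M - q < p := by rw [mem_range] at hp; omega
    simp [Nat.choose_eq_zero_of_lt hlt]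

/-- The products `Pᵉ Qʳ` are, up to nonzero factors, the coefficients of `zᵉ` in `(z P + Q)ᵉ⁺ʳ`. -/
theorem map_mul_eq_zero_of_infinite {R : Type} [CommRing R] [Algebra ℂ R] (L : R →ₗ[ℂ] ℂ)
    (P Q f : R) {s : Set ℂ} (hs : s.Infinite)
    (h : ∀ z ∈ s, ∀ M : ℕ, L ((z • P + Q) ^ M * f) = 0) (e r : ℕ) : L (P ^ e * Q ^ r * f) = 0 := by
  have := coeff_eq_zero_of_infinite hs (n := e + r + 1)
    (c := fun i => ((e + r).choose i : ℂ) * L (P ^ i * Q ^ (e + r - i) * f)) (fun z hz => ?_)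
    (by omega : e < e + r + 1)
  · simpa [Nat.choose_eq_zero_iff] using this
  · rw [← h z hz (e + r), add_pow, sum_mul, map_sum]
    refine Finset.sum_congr rfl fun i _ => ?_
    have e (u w : ℂ) (x : R) : u * L x * w = L ((u * w) • x) := by
      rw [map_smul, smul_eq_mul]; ring
    rw [e]
    congr 1
    simp only [Algebra.smul_def, map_mul, map_pow, map_natCast]
    ring

theorem map_mul_eq_zero_of_monomial {σ : Type} (L : MvPolynomial (σ ⊕ σ) ℂ →ₗ[ℂ] ℂ)
    (g : MvPolynomial (σ ⊕ σ) ℂ)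
    (h : ∀ n m : Occ σ, L (monomial (Finsupp.sumElim n m) 1 * g) = 0)
    (f : MvPolynomial (σ ⊕ σ) ℂ) : L (f * g) = 0 := by
  induction f using MvPolynomial.induction_on' with
  | monomial d c =>
    obtain ⟨n, m, rfl⟩ := exists_eq_sumElim d
    have e : monomial (Finsupp.sumElim n m) c = c • monomial (Finsupp.sumElim n m) (1 : ℂ) := by
      simp [smul_monomial]
    rw [e, smul_mul_assoc, map_smul, h, smul_zero]
  | add p q hp hq => rw [add_mul, map_add, hp, hq, add_zero]

/-! ### Separation of the block photon numbers -/

section cutoff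

variable {σ : Type} [Fintype σ] {N : ℕ} {D : Occ σ → Occ σ → ℂ}

theorem pairing_mul_X_inl_pow (hD : ∀ n m, N < n.degree → D n m = 0) (i : σ) {q : ℕ} (hq : N < q)
    (f : MvPolynomial (σ ⊕ σ) ℂ) : pairing D (f * X (Sum.inl i) ^ q) = 0 := by
  refine map_mul_eq_zero_of_monomial _ _ (fun n m => ?_) f
  rw [X_pow_eq_monomial, monomial_mul, ← Finsupp.sumElim_single_zero, ← Finsupp.sumElim_add,
    pairing_monomial, hD, mul_zero, mul_zero]
  rw [map_add, Finsupp.degree_single]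
  omega

theorem pairing_mul_X_inr_pow (hD : ∀ n m, N < m.degree → D n m = 0) (i : σ) {q : ℕ} (hq : N < q)
    (f : MvPolynomial (σ ⊕ σ) ℂ) : pairing D (f * X (Sum.inr i) ^ q) = 0 := by
  refine map_mul_eq_zero_of_monomial _ _ (fun n m => ?_) f
  rw [X_pow_eq_monomial, monomial_mul, ← Finsupp.sumElim_zero_single, ← Finsupp.sumElim_add,
    pairing_monomial, hD, mul_zero, mul_zero]
  rw [map_add, Finsupp.degree_single]
  omega

end cutoff

section counters

variable {S₁ S₂ : ℕ} [NeZero S₁]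

/-- The polynomial `∑ⱼ s₁ⱼ t₁ⱼ` for the photon number of the first block. -/
def blockPoly₁ (S₁ S₂ : ℕ) : MvPolynomial (Modes S₁ S₂ ⊕ Modes S₁ S₂) ℂ :=
  ∑ i : Fin S₁, X (Sum.inl (Sum.inl i)) * X (Sum.inr (Sum.inl i))

/-- The polynomial `∑ⱼ s₂ⱼ t₂ⱼ` for the photon number of the second block. -/
def blockPoly₂ (S₁ S₂ : ℕ) : MvPolynomial (Modes S₁ S₂ ⊕ Modes S₁ S₂) ℂ :=
  ∑ i : Fin S₂, X (Sum.inl (Sum.inr i)) * X (Sum.inr (Sum.inr i))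

theorem sum_blocks (F : Modes S₁ S₂ → MvPolynomial (Modes S₁ S₂ ⊕ Modes S₁ S₂) ℂ) (a b : ℂ)
    (G : MvPolynomial (Modes S₁ S₂ ⊕ Modes S₁ S₂) ℂ)
    (h₀ : F (Sum.inl 0) = C a * (X (Sum.inl (Sum.inl 0)) * X (Sum.inr (Sum.inl 0))) + G)
    (h₁ : ∀ i : Fin S₁, i ≠ 0 →
      F (Sum.inl i) = C a * (X (Sum.inl (Sum.inl i)) * X (Sum.inr (Sum.inl i))))
    (h₂ : ∀ i : Fin S₂, F (Sum.inr i) = C b * (X (Sum.inl (Sum.inr i)) * X (Sum.inr (Sum.inr i)))) :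
    ∑ i, F i = C a * blockPoly₁ S₁ S₂ + C b * blockPoly₂ S₁ S₂ + G := by
  have h (i : Fin S₁) : F (Sum.inl i) =
      C a * (X (Sum.inl (Sum.inl i)) * X (Sum.inr (Sum.inl i))) + if i = 0 then G else 0 := by
    split_ifs with hi
    · rw [hi, h₀]
    · rw [h₁ i hi, add_zero]
  rw [Fintype.sum_sum_type]
  simp only [h, h₂, sum_add_distrib, sum_ite_eq', mem_univ, if_true, ← mul_sum, blockPoly₁,
    blockPoly₂]
  ring

theorem counterPoly₁_eq (η ζ : Fin 2 → ℝ) (γ : ℂ) :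
    counterPoly₁ (S₁ := S₁) (S₂ := S₂) η ζ γ =
      C ((η 0 : ℂ) ^ 2) * blockPoly₁ S₁ S₂ + C ((η 1 : ℂ) ^ 2) * blockPoly₂ S₁ S₂ +
      (C ((η 0 : ℂ) * ζ 0) *
        (C γ * X (Sum.inr (Sum.inl 0)) + C (star γ) * X (Sum.inl (Sum.inl 0))) +
      C ((ζ 0 : ℂ) ^ 2 * (γ * star γ))) := by
  rw [counterPoly₁]
  refine sum_blocks _ _ _ _ ?_ (fun i hi => ?_) fun i => ?_
  · simp [ketHom, braHom, outputCreator, block, probeAmp, -Complex.star_def]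
    ring
  · simp [ketHom, braHom, outputCreator, block, probeAmp, hi]
    ring
  · simp [ketHom, braHom, outputCreator, block, probeAmp]
    ring

theorem counterPoly₂_eq (η ζ : Fin 2 → ℝ) (γ : ℂ) :
    counterPoly₂ (S₁ := S₁) (S₂ := S₂) η ζ γ =
      C ((ζ 0 : ℂ) ^ 2) * blockPoly₁ S₁ S₂ + C ((ζ 1 : ℂ) ^ 2) * blockPoly₂ S₁ S₂ +
      (-C ((η 0 : ℂ) * ζ 0) *
        (C γ * X (Sum.inr (Sum.inl 0)) + C (star γ) * X (Sum.inl (Sum.inl 0))) +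
      C ((η 0 : ℂ) ^ 2 * (γ * star γ))) := by
  rw [counterPoly₂]
  refine sum_blocks _ _ _ _ ?_ (fun i hi => ?_) fun i => ?_
  · simp [ketHom, braHom, outputCreator, block, probeAmp, -Complex.star_def]
    ring
  · simp [ketHom, braHom, outputCreator, block, probeAmp, hi]
    ring
  · simp [ketHom, braHom, outputCreator, block, probeAmp]
    ring

theorem sum_mem_polySpace (N n : ℕ) (c : ℕ → ℕ → ℂ) (hp : ∀ p q, N < p → c p q = 0)
    (hq : ∀ p q, N < q → c p q = 0) :
    (fun z : ℂ => ∑ p ∈ range n, ∑ q ∈ range n, c p q * (z ^ p * star z ^ q)) ∈ polySpace N := by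
  have : (fun z : ℂ => ∑ p ∈ range n, ∑ q ∈ range n, c p q * (z ^ p * star z ^ q)) =
      ∑ p ∈ range n, ∑ q ∈ range n, c p q • fun z : ℂ => z ^ p * star z ^ q := by
    ext z
    simp
  rw [this]
  refine Submodule.sum_mem _ fun p _ => Submodule.sum_mem _ fun q _ => ?_
  by_cases h1 : N < p
  · rw [hp p q h1, zero_smul]
    exact Submodule.zero_mem _
  by_cases h2 : N < q
  · rw [hq p q h2, zero_smul]
    exact Submodule.zero_mem _
  exact Submodule.smul_mem _ _ (Submodule.subset_span ⟨p, not_lt.1 h1, q, not_lt.1 h2, rfl⟩)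

variable {N : ℕ} {D : Occ (Modes S₁ S₂) → Occ (Modes S₁ S₂) → ℂ}

/-- If the powers of the counter polynomials pair to zero on a unisolvent set of probe amplitudes,
then so do they for every amplitude, and comparing coefficients of `γᵖ (γ*)ᵠ` isolates powers of a
combination of the block photon numbers times powers of the two variables of the probed mode. -/
theorem pairing_combination_eq_zero {η ζ : Fin 2 → ℝ} {Γ : Finset ℂ} (hΓ : IsUnisolvent N Γ)
    (hη : η 0 ≠ 0) (hζ : ζ 0 ≠ 0) (hD₁ : ∀ n m, N < n.degree → D n m = 0)
    (hD₂ : ∀ n m, N < m.degree → D n m = 0)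
    (h : ∀ γ ∈ Γ, ∀ k l : ℕ,
      pairing D (counterPoly₁ η ζ γ ^ k * counterPoly₂ η ζ γ ^ l) = 0)
    {x y : ℂ} (hxy : x ≠ y) (r p q : ℕ) :
    pairing D ((C (x * η 0 ^ 2 + y * ζ 0 ^ 2) * blockPoly₁ S₁ S₂ +
      C (x * η 1 ^ 2 + y * ζ 1 ^ 2) * blockPoly₂ S₁ S₂) ^ r *
      (X (Sum.inr (Sum.inl 0)) ^ p * X (Sum.inl (Sum.inl 0)) ^ q)) = 0 := by
  set Z := C (x * η 0 ^ 2 + y * ζ 0 ^ 2) * blockPoly₁ S₁ S₂ +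
      C (x * η 1 ^ 2 + y * ζ 1 ^ 2) * blockPoly₂ S₁ S₂ with hZ
  set d : ℂ := (x - y) * (η 0 * ζ 0) with hd
  have hd0 : d ≠ 0 := by
    have h1 : (η 0 : ℂ) ≠ 0 := by exact_mod_cast hη
    have h2 : (ζ 0 : ℂ) ≠ 0 := by exact_mod_cast hζ
    exact mul_ne_zero (sub_ne_zero.2 hxy) (mul_ne_zero h1 h2)
  set t : MvPolynomial (Modes S₁ S₂ ⊕ Modes S₁ S₂) ℂ := X (Sum.inr (Sum.inl 0))
  set s : MvPolynomial (Modes S₁ S₂ ⊕ Modes S₁ S₂) ℂ := X (Sum.inl (Sum.inl 0))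
  -- The constant terms `ζ₁² |γ|²` and `η₁² |γ|²` of the counter polynomials lie in every subalgebra.
  -- Removing them leaves a polynomial whose powers pair to functions in `polySpace N`.
  have hmem (γ : ℂ) : Z + γ • d • t + star γ • d • s ∈
      Algebra.adjoin ℂ {counterPoly₁ η ζ γ, counterPoly₂ η ζ γ} := by
    have e : Z + γ • d • t + star γ • d • s =
        x • counterPoly₁ η ζ γ + y • counterPoly₂ η ζ γ -
          algebraMap ℂ _ ((x * ζ 0 ^ 2 + y * η 0 ^ 2) * (γ * star γ)) := by
      rw [counterPoly₁_eq, counterPoly₂_eq, hZ, hd]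
      simp only [smul_eq_C_mul, algebraMap_eq, map_add, map_mul, map_pow, map_sub]
      ring
    rw [e]
    exact sub_mem (add_mem (Subalgebra.smul_mem _ (Algebra.subset_adjoin (by simp)) _)
      (Subalgebra.smul_mem _ (Algebra.subset_adjoin (by simp)) _)) (Subalgebra.algebraMap_mem _ _)
  set M := r + p + q with hM
  set c : ℕ → ℕ → ℂ := fun p q => (M.choose q : ℂ) * ((M - q).choose p : ℂ) *
    pairing D (Z ^ (M - q - p) * (d • t) ^ p * (d • s) ^ q) with hc
  have hmono (r p q : ℕ) : pairing D (Z ^ r * (d • t) ^ p * (d • s) ^ q) =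
      d ^ p * d ^ q * pairing D (Z ^ r * (t ^ p * s ^ q)) := by
    rw [← smul_eq_mul (d ^ p * d ^ q), ← map_smul]
    congr 1
    simp only [smul_eq_C_mul, map_mul, map_pow]
    ring
  have hcp (p q) (hp : N < p) : c p q = 0 := by
    simp only [hc, hmono]
    rw [mul_comm (t ^ p), ← mul_assoc (Z ^ _), pairing_mul_X_inr_pow hD₂ _ hp, mul_zero, mul_zero]
  have hcq (p q) (hq : N < q) : c p q = 0 := by
    simp only [hc, hmono]
    rw [← mul_assoc (Z ^ _), pairing_mul_X_inl_pow hD₁ _ hq, mul_zero, mul_zero]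
  have hzero := hΓ _ (sum_mem_polySpace N (M + 1) c hcp hcq) fun γ hγ => by
    rw [← map_trinomial_pow (pairing D) Z (d • t) (d • s) γ (star γ) M]
    exact map_eq_zero_of_mem_adjoin_pair _ (h γ hγ) (pow_mem (hmem γ) M)
  have hcpq : c p q = 0 := coeff_eq_zero_of_conj (fun z => congrFun hzero z)
    (by omega : p < M + 1) (by omega : q < M + 1)
  have e1 : M - q - p = r := by omega
  have h1 : (M.choose q : ℂ) ≠ 0 := by
    exact_mod_cast (Nat.choose_pos (by omega)).ne'
  have h2 : ((M - q).choose p : ℂ) ≠ 0 := by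
    exact_mod_cast (Nat.choose_pos (by omega)).ne'
  simp only [hc, hmono, e1] at hcpq
  simpa [h1, h2, hd0] using hcpq

/-- The two blocks have different reflectivities, so their photon numbers can be separated. -/
theorem pairing_blockPoly_eq_zero {η ζ : Fin 2 → ℝ} (hunit : ∀ i, η i ^ 2 + ζ i ^ 2 = 1)
    {Γ : Finset ℂ} (hΓ : IsUnisolvent N Γ) (hη : η 0 ≠ 0) (hζ : ζ 0 ≠ 0)
    (hdistinct : η 0 ^ 2 ≠ η 1 ^ 2) (hD₁ : ∀ n m, N < n.degree → D n m = 0)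
    (hD₂ : ∀ n m, N < m.degree → D n m = 0)
    (h : ∀ γ ∈ Γ, ∀ k l : ℕ,
      pairing D (counterPoly₁ η ζ γ ^ k * counterPoly₂ η ζ γ ^ l) = 0) (e f p q : ℕ) :
    pairing D (blockPoly₁ S₁ S₂ ^ e * blockPoly₂ S₁ S₂ ^ f *
      (X (Sum.inr (Sum.inl 0)) ^ p * X (Sum.inl (Sum.inl 0)) ^ q)) = 0 := by
  refine map_mul_eq_zero_of_infinite _ _ _ _ (Set.finite_singleton (1 : ℂ)).infinite_compl
    (fun z hz M => ?_) e f
  have hu (i) : (η i : ℂ) ^ 2 + (ζ i : ℂ) ^ 2 = 1 := by exact_mod_cast hunit i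
  have hδ : (η 0 : ℂ) ^ 2 - (η 1 : ℂ) ^ 2 ≠ 0 := sub_ne_zero.2 (by exact_mod_cast hdistinct)
  -- `x` and `y` solve `x η₁² + y ζ₁² = z`, `x η₂² + y ζ₂² = 1`, of determinant `η₁² - η₂²`.
  have := pairing_combination_eq_zero hΓ hη hζ hD₁ hD₂ h
    (x := (z * ζ 1 ^ 2 - ζ 0 ^ 2) / ((η 0 : ℂ) ^ 2 - (η 1 : ℂ) ^ 2))
    (y := (η 0 ^ 2 - z * η 1 ^ 2) / ((η 0 : ℂ) ^ 2 - (η 1 : ℂ) ^ 2)) (fun hxy => ?_) M p q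
  · convert this using 4
    rw [smul_eq_C_mul]
    congr 1
    · congr 2
      field_simp
      linear_combination (z * η 1 ^ 2) * hu 0 - (z * η 0 ^ 2) * hu 1
    · rw [show ((z * ζ 1 ^ 2 - ζ 0 ^ 2) / ((η 0 : ℂ) ^ 2 - (η 1 : ℂ) ^ 2) * (η 1 : ℂ) ^ 2 +
        (η 0 ^ 2 - z * η 1 ^ 2) / ((η 0 : ℂ) ^ 2 - (η 1 : ℂ) ^ 2) * (ζ 1 : ℂ) ^ 2) = 1 by
          field_simp
          linear_combination (η 0 : ℂ) ^ 2 * hu 1 - (η 1 : ℂ) ^ 2 * hu 0, C_1, one_mul]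
  · rw [div_left_inj' hδ] at hxy
    exact hz (by
      show z = 1
      linear_combination hxy - z * hu 1 + hu 0)

end counters

/-! ### Reconstruction of twirled matrices -/

theorem inl_one_ne_inl_zero {S₁ S₂ : ℕ} [NeZero S₁] (hS₁ : 1 < S₁) :
    (Sum.inl 1 : Modes S₁ S₂) ≠ Sum.inl 0 := by
  obtain ⟨n, rfl⟩ : ∃ n, S₁ = n + 2 := ⟨S₁ - 2, by omega⟩
  simp

section twirled

variable {S₁ S₂ : ℕ} [NeZero S₁] [NeZero S₂]

/-- The occupation numbers `a`, `i`, `f` of the three modes on which a twirled state lives. -/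
def occ₃ (S₁ S₂ : ℕ) [NeZero S₁] [NeZero S₂] (a i f : ℕ) : Occ (Modes S₁ S₂) :=
  Finsupp.single (Sum.inl 0) a + Finsupp.single (Sum.inl 1) i + Finsupp.single (Sum.inr 0) f

open Classical in
/-- The indicator of the three modes on which a twirled state lives. -/
def keep (i : Modes S₁ S₂) : ℂ :=
  if i = Sum.inl 0 ∨ i = Sum.inl 1 ∨ i = Sum.inr 0 then 1 else 0

/-- The algebra homomorphism setting the variables of all modes to zero except for those of the
three modes on which a twirled state lives. -/
def vacuumHom (S₁ S₂ : ℕ) [NeZero S₁] [NeZero S₂] :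
    MvPolynomial (Modes S₁ S₂ ⊕ Modes S₁ S₂) ℂ →ₐ[ℂ] MvPolynomial (Modes S₁ S₂ ⊕ Modes S₁ S₂) ℂ :=
  aeval fun i => C (Sum.elim keep keep i) * X i

theorem vacuumHom_X (i : Modes S₁ S₂ ⊕ Modes S₁ S₂) :
    vacuumHom S₁ S₂ (X i) = C (Sum.elim keep keep i) * X i := aeval_X _ _

/-- The support condition of a twirled state, for a matrix in the Fock basis. -/
def IsTwirledMatrix (D : Occ (Modes S₁ S₂) → Occ (Modes S₁ S₂) → ℂ) : Prop :=
  ∀ n m : Occ (Modes S₁ S₂), D n m ≠ 0 →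
    (∀ i, i ≠ Sum.inl 0 → n i = m i) ∧
    (∀ i, i ≠ Sum.inl 0 → i ≠ Sum.inl 1 → i ≠ Sum.inr 0 → n i = 0)

variable {D : Occ (Modes S₁ S₂) → Occ (Modes S₁ S₂) → ℂ}

/-- Entries of a twirled matrix outside the three modes vanish, so the pairing ignores the variables
of all other modes. -/
theorem pairing_vacuumHom (hD : IsTwirledMatrix D)
    (f : MvPolynomial (Modes S₁ S₂ ⊕ Modes S₁ S₂) ℂ) :
    pairing D (vacuumHom S₁ S₂ f) = pairing D f := by
  induction f using MvPolynomial.induction_on' with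
  | monomial d c =>
    have h : vacuumHom S₁ S₂ (monomial d c) =
        (∏ i, Sum.elim keep keep i ^ d i) • monomial d c := by
      rw [vacuumHom, aeval_monomial, Finsupp.prod_fintype _ _ (by simp)]
      simp only [mul_pow, prod_mul_distrib]
      rw [monomial_eq, Finsupp.prod_fintype _ _ (by simp), algebraMap_eq, smul_eq_C_mul]
      simp only [map_prod, map_pow]
      ring
    rw [h, map_smul]
    obtain ⟨n, m, rfl⟩ := exists_eq_sumElim d
    by_cases hz : D n m = 0
    · simp [pairing_monomial, hz]
    · obtain ⟨h1, h2⟩ := hD n m hz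
      rw [Finset.prod_eq_one, one_smul]
      have hk (i : Modes S₁ S₂) : keep i = 1 ∨ n i = 0 ∧ m i = 0 := by
        by_cases hi : i = Sum.inl 0 ∨ i = Sum.inl 1 ∨ i = Sum.inr 0
        · exact Or.inl (if_pos hi)
        · push Not at hi
          have := h2 i hi.1 hi.2.1 hi.2.2
          exact Or.inr ⟨this, by rw [← h1 i hi.1, this]⟩
      rintro (i | i) - <;> rcases hk i with h | h <;> simp [h]
  | add p q hp hq => simp only [map_add, hp, hq]

theorem vacuumHom_blockPoly₁ (hS₁ : 1 < S₁) : vacuumHom S₁ S₂ (blockPoly₁ S₁ S₂) =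
    X (Sum.inl (Sum.inl 0)) * X (Sum.inr (Sum.inl 0)) +
      X (Sum.inl (Sum.inl 1)) * X (Sum.inr (Sum.inl 1)) := by
  have h10 : (0 : Fin S₁) ≠ 1 := fun h => inl_one_ne_inl_zero (S₂ := S₂) hS₁ (by rw [h])
  simp only [blockPoly₁, map_sum, map_mul, vacuumHom_X, Sum.elim_inl, Sum.elim_inr]
  rw [Fintype.sum_eq_add 0 1 h10]
  · simp [keep]
  · rintro i ⟨hi0, hi1⟩
    simp [keep, hi0, hi1]

theorem vacuumHom_blockPoly₂ : vacuumHom S₁ S₂ (blockPoly₂ S₁ S₂) =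
    X (Sum.inl (Sum.inr 0)) * X (Sum.inr (Sum.inr 0)) := by
  simp only [blockPoly₂, map_sum, map_mul, vacuumHom_X, Sum.elim_inl, Sum.elim_inr]
  rw [Fintype.sum_eq_single 0]
  · simp [keep]
  · intro i hi
    simp [keep, hi]

theorem monomial_occ₃ (a b i f : ℕ) :
    (X (Sum.inl (Sum.inl 0)) ^ a * X (Sum.inr (Sum.inl 0)) ^ b) *
      (X (Sum.inl (Sum.inl 1)) * X (Sum.inr (Sum.inl 1))) ^ i *
      (X (Sum.inl (Sum.inr 0)) * X (Sum.inr (Sum.inr 0))) ^ f =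
    monomial (Finsupp.sumElim (occ₃ S₁ S₂ a i f) (occ₃ S₁ S₂ b i f)) (1 : ℂ) := by
  simp only [mul_pow, X_pow_eq_monomial, monomial_mul, mul_one]
  congr 1
  simp only [← Finsupp.sumElim_single_zero, ← Finsupp.sumElim_zero_single, ← Finsupp.sumElim_add,
    add_zero, zero_add, occ₃]

/-- A twirled matrix is determined by its pairings with the products of block photon numbers and
powers of the variables of the first mode. By induction on the occupation number of the second
mode, the binomial expansion of the first block photon number leaves a single unknown entry. -/
theorem entry_occ₃_eq_zero (hS₁ : 1 < S₁) (hD : IsTwirledMatrix D)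
    (h : ∀ e f p q : ℕ, pairing D (blockPoly₁ S₁ S₂ ^ e * blockPoly₂ S₁ S₂ ^ f *
      (X (Sum.inr (Sum.inl 0)) ^ p * X (Sum.inl (Sum.inl 0)) ^ q)) = 0) (i : ℕ) :
    ∀ a b f : ℕ, D (occ₃ S₁ S₂ a i f) (occ₃ S₁ S₂ b i f) = 0 := by
  induction i using Nat.strong_induction_on with
  | _ i ih =>
    intro a b f
    have h1 := h i f b a
    rw [← pairing_vacuumHom hD] at h1
    simp only [map_mul, map_pow, vacuumHom_blockPoly₁ hS₁, vacuumHom_blockPoly₂, vacuumHom_X,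
      Sum.elim_inl, Sum.elim_inr] at h1
    simp only [keep, true_or, if_true, C_1, one_mul] at h1
    -- Only the term with all `i` photons of the first block in the second mode survives.
    rw [add_pow, sum_mul, sum_mul, map_sum, Finset.sum_eq_single 0] at h1
    · have e := monomial_occ₃ (S₁ := S₁) (S₂ := S₂) a b i f
      rw [pow_zero, one_mul, Nat.choose_zero_right, Nat.cast_one, mul_one, Nat.sub_zero,
        show ∀ u v w z : MvPolynomial (Modes S₁ S₂ ⊕ Modes S₁ S₂) ℂ,
          u * v * (w * z) = (z * w) * u * v by intros; ring, e, pairing_monomial, one_mul] at h1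
      have hpos (n : Occ (Modes S₁ S₂)) : √(occFactorial n : ℝ) ≠ 0 :=
        (Real.sqrt_pos.2 (by exact_mod_cast occFactorial_pos n)).ne'
      refine (mul_eq_zero.1 h1).resolve_left ?_
      exact Complex.ofReal_ne_zero.2 (mul_ne_zero (hpos _) (hpos _))
    · intro n hn hn0
      have hni : n ≤ i := by simpa [Nat.lt_succ_iff] using hn
      have e := monomial_occ₃ (S₁ := S₁) (S₂ := S₂) (n + a) (n + b) (i - n) f
      rw [show ∀ u v : MvPolynomial (Modes S₁ S₂ ⊕ Modes S₁ S₂) ℂ, ∀ s t : _, ∀ c : ℕ,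
          (s * t) ^ n * u * (c : MvPolynomial (Modes S₁ S₂ ⊕ Modes S₁ S₂) ℂ) * v *
            (t ^ b * s ^ a) = c • ((s ^ (n + a) * t ^ (n + b)) * u * v) by
            intros; rw [nsmul_eq_mul]; ring, e, map_nsmul, pairing_monomial,
        ih (i - n) (by omega)]
      simp
    · simp

theorem matrix_eq_zero (hS₁ : 1 < S₁) (hD : IsTwirledMatrix D)
    (h : ∀ e f p q : ℕ, pairing D (blockPoly₁ S₁ S₂ ^ e * blockPoly₂ S₁ S₂ ^ f *
      (X (Sum.inr (Sum.inl 0)) ^ p * X (Sum.inl (Sum.inl 0)) ^ q)) = 0)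
    (n m : Occ (Modes S₁ S₂)) : D n m = 0 := by
  by_contra hz
  obtain ⟨h1, h2⟩ := hD n m hz
  have h10 := inl_one_ne_inl_zero (S₂ := S₂) hS₁
  have hocc (n : Occ (Modes S₁ S₂))
      (h : ∀ i, i ≠ Sum.inl 0 → i ≠ Sum.inl 1 → i ≠ Sum.inr 0 → n i = 0) :
      n = occ₃ S₁ S₂ (n (Sum.inl 0)) (n (Sum.inl 1)) (n (Sum.inr 0)) := by
    ext i
    by_cases hi0 : i = Sum.inl 0
    · subst hi0
      simp [occ₃, h10]
    by_cases hi1 : i = Sum.inl 1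
    · subst hi1
      simp [occ₃, h10.symm]
    by_cases hi2 : i = Sum.inr 0
    · subst hi2
      simp [occ₃]
    rw [h i hi0 hi1 hi2]
    simp [occ₃, Ne.symm hi0, Ne.symm hi1, Ne.symm hi2]
  rw [hocc n h2, hocc m fun i a b c => by rw [← h1 i a, h2 i a b c], ← h1 _ h10,
    ← h1 (Sum.inr 0) (by simp)] at hz
  exact hz (entry_occ₃_eq_zero hS₁ hD h _ _ _ _)

end twirled

/-! ### Operators in the Fock basis -/

section operators

variable {σ : Type}

theorem elem_eq_coord (ρ : Fock σ →L[ℂ] Fock σ) (n m : Occ σ) : elem ρ n m = ρ (ket m) n := by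
  classical
  rw [elem, ket, lp.inner_single_left]
  simp

/-- Bounded operators are determined by their matrix elements in the Fock basis. -/
theorem ext_elem {ρ ρ' : Fock σ →L[ℂ] Fock σ} (h : ∀ n m, elem ρ n m = elem ρ' n m) : ρ = ρ' := by
  classical
  have hket (m : Occ σ) : ρ (ket m) = ρ' (ket m) := by
    ext n
    rw [← elem_eq_coord, ← elem_eq_coord, h]
  ext1 f
  have hf : HasSum (fun n => f n • ket n) f := by
    convert lp.hasSum_single ENNReal.ofNat_ne_top f using 2 with n
    rw [ket, ← lp.single_smul]
    simp
  have h1 := ρ.hasSum hf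
  have h2 := ρ'.hasSum hf
  simp only [map_smul, hket] at h1 h2
  exact h1.unique h2

theorem elem_eq_zero_of_right {ρ : Fock σ →L[ℂ] Fock σ} {N : ℕ} (hN : HasAtMostPhotons N ρ)
    (n m : Occ σ) (hm : N < m.degree) : elem ρ n m = 0 := by
  rw [elem, hN m hm, inner_zero_right]

/-- A positive operator is symmetric, so the photon bound also holds for the row index. -/
theorem elem_eq_zero_of_left {ρ : Fock σ →L[ℂ] Fock σ} (hρ : ρ.IsPositive) {N : ℕ}
    (hN : HasAtMostPhotons N ρ) (n m : Occ σ) (hn : N < n.degree) : elem ρ n m = 0 := by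
  have h := hρ.isSymmetric (ket n) (ket m)
  rw [elem]
  refine h.symm.trans ?_
  change inner ℂ (ρ (ket n)) (ket m) = 0
  rw [hN n hn, inner_zero_left]

end operators

/-- Twirled states with boundedly many photons are determined by the outcome statistics. -/
theorem eq_of_outcomeProb_eq {S₁ S₂ : ℕ} [NeZero S₁] [NeZero S₂] (hS₁ : 1 < S₁)
    {η ζ : Fin 2 → ℝ} (hunit : ∀ i, η i ^ 2 + ζ i ^ 2 = 1)
    (hη₁ : η 0 ≠ 0) (hζ₁ : ζ 0 ≠ 0) (hdistinct : η 0 ^ 2 ≠ η 1 ^ 2)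
    {N : ℕ} {Γ : Finset ℂ} (hΓ : IsUnisolvent N Γ)
    {ρ ρ' : Fock (Modes S₁ S₂) →L[ℂ] Fock (Modes S₁ S₂)}
    (hρ : ρ.IsPositive) (hρ' : ρ'.IsPositive) (htw : IsTwirled ρ) (htw' : IsTwirled ρ')
    (hN : HasAtMostPhotons N ρ) (hN' : HasAtMostPhotons N ρ')
    (hstat : ∀ γ ∈ Γ, ∀ k l : ℕ, outcomeProb η ζ ρ γ k l = outcomeProb η ζ ρ' γ k l) :
    ρ = ρ' := by
  refine ext_elem fun n m => sub_eq_zero.1 ?_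
  refine matrix_eq_zero (D := fun n m => elem ρ n m - elem ρ' n m) hS₁ (fun n m hnm => ?_)
    (pairing_blockPoly_eq_zero hunit hΓ hη₁ hζ₁ hdistinct (fun n m hn => ?_) (fun n m hm => ?_)
      fun γ hγ k l => ?_) n m
  · by_cases h : elem ρ n m = 0
    · exact htw' n m fun h' => hnm (by simp [h, h'])
    · exact htw n m h
  · rw [elem_eq_zero_of_left hρ hN n m hn, elem_eq_zero_of_left hρ' hN' n m hn, sub_zero]
  · rw [elem_eq_zero_of_right hN n m hm, elem_eq_zero_of_right hN' n m hm, sub_zero]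
  · have h := hstat γ hγ k l
    rw [outcomeProb_eq, outcomeProb_eq] at h
    rw [pairing_sub, sub_eq_zero]
    refine mul_left_cancel₀ (mul_ne_zero ?_ (mul_ne_zero ?_ ?_)) h
    · exact Complex.ofReal_ne_zero.2 (Real.exp_pos _).ne'
    · exact inv_ne_zero (by exact_mod_cast k.factorial_ne_zero)
    · exact inv_ne_zero (by exact_mod_cast l.factorial_ne_zero)

end WFH

end

theorem mainTheorem8 (S₁ S₂ : ℕ) [NeZero S₁] [NeZero S₂] (hS₁ : 1 < S₁)
    (η ζ : Fin 2 → ℝ) (hunit : ∀ i, η i ^ 2 + ζ i ^ 2 = 1)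
    (hη₁ : η 0 ≠ 0) (hζ₁ : ζ 0 ≠ 0) (hdistinct : η 0 ^ 2 ≠ η 1 ^ 2)
    (N : ℕ) (Γ : Finset ℂ) (hΓ : WFH.IsUnisolvent N Γ)
    (ρ ρ' : WFH.Fock (WFH.Modes S₁ S₂) →L[ℂ] WFH.Fock (WFH.Modes S₁ S₂))
    (hρ : WFH.IsDensityOperator ρ) (hρ' : WFH.IsDensityOperator ρ')
    (htw : WFH.IsTwirled ρ) (htw' : WFH.IsTwirled ρ')
    (hN : WFH.HasAtMostPhotons N ρ) (hN' : WFH.HasAtMostPhotons N ρ')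
    (hstat : ∀ γ ∈ Γ, ∀ k l : ℕ,
      WFH.outcomeProb η ζ ρ γ k l = WFH.outcomeProb η ζ ρ' γ k l) :
    (∀ k l c₁ c₂ : ℕ, max k l + c₁ + c₂ ≤ N →
      WFH.expectation ρ (WFH.mPoly S₁ S₂ k l c₁ c₂) =
        WFH.expectation ρ' (WFH.mPoly S₁ S₂ k l c₁ c₂) ∧
      WFH.expectation ρ (WFH.mPrimePoly S₁ S₂ k l c₁ c₂) =
        WFH.expectation ρ' (WFH.mPrimePoly S₁ S₂ k l c₁ c₂)) ∧
    ρ = ρ' := by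
  have h : ρ = ρ' := WFH.eq_of_outcomeProb_eq hS₁ hunit hη₁ hζ₁ hdistinct hΓ hρ.1 hρ'.1 htw htw'
    hN hN' hstat
  subst h
  exact ⟨fun _ _ _ _ _ => ⟨rfl, rfl⟩, rfl⟩
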